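/- Let $B$ be a standard Brownian motion with almost surely continuous paths, let $S(u)=B(u+1)-B(u)$, $u\in[0,1]$, be the Slepian process, and let $m_s=\max_{0\le u\le s}S(u)$ and $M_t=\max_{0\le u\le t}S(u)$ be its running maxima. Let $0<s\le t\le 1$ and let $m\le M$ be real numbers. Put $$\overline s=\frac{s}{2-s},\quad T=\frac{t}{2-t},\quad p=\frac{\overline s-1}{2},\quad q=\frac{\overline s+1}{2}\,m,\quad \eta=\frac{\overline s+1}{2}\,M,\quad \delta=\sqrt{T-\overline s},$$ and let $\Phi$ be the distribution function of $N(0,1)$. Then $$\mathbb P(m_s\le m,\ M_t\le M)=\int_{-\infty}^{m}\int_{-\infty}^{px+q}\frac{1}{2\pi\sqrt{\overline s}}\,e^{-\frac{y^2}{2\overline s}}\,e^{-\frac{x^2}{2}}\Bigl\{1-e^{-\frac{(m-x)(px+q-y)}{\overline s}}\Bigr\}\,L(x,y)\,dy\,dx,$$ where, if $s<t$, $$L(x,y)=\Phi\Bigl(\frac{px+\eta-y}{\delta}+\frac{M+x}{2}\,\delta\Bigr)-e^{-(M+x)(px+\eta-y)}\,\Phi\Bigl(\frac{M+x}{2}\,\delta-\frac{px+\eta-y}{\delta}\Bigr),$$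 and, if $s=t$ (so that $\delta=0$), $L(x,y)=1$, which is the limit of the preceding expression as $\delta\downarrow 0$. The integrand is integrable over the region of integration. -/

import Mathlib

open MeasureTheory ProbabilityTheory
open scoped NNReal

noncomputable section

namespace Slepian

/-- The Slepian process `S(u) = B(u + 1) - B(u)` built from a process `B`. -/
def slepian {Ω : Type*} (B : ℝ≥0 → Ω → ℝ) (u : ℝ≥0) (ω : Ω) : ℝ :=
  B (u + 1) ω - B u ω

/-- The running maximum `max_{0 ≤ u ≤ s} S(u)` of the Slepian process. If the path of `B` is
continuous, then the supremum is taken over a nonempty compact set, so it is a maximum. -/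
def runningMax {Ω : Type*} (B : ℝ≥0 → Ω → ℝ) (s : ℝ≥0) (ω : Ω) : ℝ :=
  sSup ((fun u : ℝ≥0 => slepian B u ω) '' Set.Icc 0 s)

/-- The distribution function of the standard normal law `N(0, 1)`. -/
def Phi (x : ℝ) : ℝ := cdf (gaussianReal 0 1) x

/-- The finite-horizon Bachelier-Levy term with horizon `δ ^ 2`, intercept `a` and slope `c`,
for `a > 0`. For `δ = 0` it is the limit as `δ` decreases to `0`, which is `1`. -/
def bachelierLevy (a c δ : ℝ) : ℝ :=
  if δ = 0 then 1
  else Phi (a / δ + c * δ) - Real.exp (-(2 * c * a)) * Phi (c * δ - a / δ)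

/-- The integrand of the joint distribution function of the two running maxima. -/
def integrand (sbar p q η δ m M x y : ℝ) : ℝ :=
  1 / (2 * Real.pi * Real.sqrt sbar) * Real.exp (-(y ^ 2 / (2 * sbar))) * Real.exp (-(x ^ 2 / 2))
    * (1 - Real.exp (-((m - x) * (p * x + q - y) / sbar)))
    * bachelierLevy (p * x + η - y) ((M + x) / 2) δ

end Slepian

end

namespace Slepian

open Filter Topology

noncomputable section

/-! ### Conditioning on one of two independent variables -/

section Independence

variable {Ω α β : Type*} [MeasurableSpace Ω] [MeasurableSpace α] [MeasurableSpace β]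
  {P : Measure Ω} {U : Ω → α} {Z : Ω → β}

/-! The Slepian process on `[0, 1]` is centred Gaussian with covariance `1 - |u - v|`. With `u =
2τ/(1+τ)`, the combination `(1+τ)/2 * S(u) - (1-τ)/2 * S(0)` is a Brownian motion `W` on `[0, 1]`
independent of `S(0)`, as a covariance computation shows (`isBrownianReal_drivingBM`,
`indepFun_slepian_zero_drivingBM`). Given `S(0) = x`, the constant barrier `m` becomes the line
`(m-x)/2 + (m+x)/2 * τ` for `W` (`slepian_clock_le_iff`), so the event says that `W` stays below one
line up to `s/(2-s)` and below a higher one afterwards.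

For a single line, the law of the endpoint on the event of no crossing follows from reflection: an
antisymmetrised test function has zero expectation when `W` is started on the line
(`integral_reflect_eq_zero`), so paths that cross contribute nothing
(`setIntegral_stayBelow_eq_integral`). This gives the density of `map_restrict_stayBelow`;
integrating it gives the Bachelier-Lévy formula `measureReal_stayBelow`. The Markov property joins
the two stages (`measure_stayBelow_inter_shift`), and integration over the normal law of `S(0)`
finishes.

No stopping times are used: crossings are detected on finite grids, and path continuity removes the
overshoot in the limit. -/

lemma _root_.ProbabilityTheory.IndepFun.integral_prodMk [IsProbabilityMeasure P]
    (h : IndepFun U Z P) (hU : AEMeasurable U P)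
    (hZ : AEMeasurable Z P) {f : α × β → ℝ} (hf : Measurable f) {C : ℝ} (hC : ∀ x, |f x| ≤ C) :
    ∫ ω, f (U ω, Z ω) ∂P = ∫ ω, ∫ z, f (U ω, z) ∂(P.map Z) ∂P := by
  have := Measure.isProbabilityMeasure_map hU
  have := Measure.isProbabilityMeasure_map hZ
  rw [← integral_map (hU.prodMk hZ) hf.aestronglyMeasurable,
    (indepFun_iff_map_prod_eq_prod_map_map hU hZ).1 h, integral_prod, integral_map hU]
  · exact (hf.stronglyMeasurable.integral_prod_right').aestronglyMeasurable
  · exact Integrable.of_bound hf.aestronglyMeasurable C (ae_of_all _ hC)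

lemma _root_.ProbabilityTheory.IndepFun.measure_prodMk_mem [IsProbabilityMeasure P]
    (h : IndepFun U Z P) (hU : AEMeasurable U P)
    (hZ : AEMeasurable Z P) {S : Set (α × β)} (hS : MeasurableSet S) :
    P {ω | (U ω, Z ω) ∈ S} = ∫⁻ u, P {ω | (u, Z ω) ∈ S} ∂(P.map U) := by
  have := Measure.isProbabilityMeasure_map hU
  have := Measure.isProbabilityMeasure_map hZ
  have h1 : P {ω | (U ω, Z ω) ∈ S} = P.map (fun ω => (U ω, Z ω)) S :=
    (Measure.map_apply_of_aemeasurable (hU.prodMk hZ) hS).symm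
  rw [h1, (indepFun_iff_map_prod_eq_prod_map_map hU hZ).1 h, Measure.prod_apply hS]
  refine lintegral_congr fun u => ?_
  rw [Measure.map_apply_of_aemeasurable hZ (measurable_prodMk_left hS)]
  rfl

end Independence

/-! ### Finite partitions that determine a continuous path -/

section Grid

/-- The `k`-th point of the partition of `[0, σ]` into `n + 1` intervals of equal length, for
`i = (n, k)`; it is `σ` if `n + 1 ≤ k`. -/
def grid (σ : ℝ≥0) (i : ℕ × ℕ) : ℝ≥0 := σ * ((min i.2 (i.1 + 1) : ℕ) / ((i.1 : ℝ≥0) + 1))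

lemma grid_le (σ : ℝ≥0) (i : ℕ × ℕ) : grid σ i ≤ σ := by
  unfold grid
  have h : ((min i.2 (i.1 + 1) : ℕ) : ℝ≥0) / ((i.1 : ℝ≥0) + 1) ≤ 1 := by
    apply div_le_one_of_le₀ _ (by positivity)
    exact_mod_cast min_le_right _ _
  calc _ ≤ σ * 1 := by gcongr
    _ = σ := mul_one _

lemma grid_mono (σ : ℝ≥0) (n : ℕ) : Monotone fun k => grid σ (n, k) := by
  intro j k hjk
  simp only [grid]
  gcongr

lemma grid_zero (σ : ℝ≥0) (n : ℕ) : grid σ (n, 0) = 0 := by simp [grid]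

lemma grid_last (σ : ℝ≥0) (n : ℕ) : grid σ (n, n + 1) = σ := by
  have : (n : ℝ≥0) + 1 ≠ 0 := by positivity
  simp [grid, this]

lemma grid_succ_sub_le (σ : ℝ≥0) (n k : ℕ) :
    (grid σ (n, k + 1) : ℝ) - grid σ (n, k) ≤ σ * (1 / ((n : ℝ) + 1)) := by
  simp only [grid]
  push_cast
  rw [← mul_sub, ← sub_div]
  gcongr
  rcases le_total (k + 1) (n + 1) with h | h
  · have h' : (k : ℝ) + 1 ≤ n + 1 := by exact_mod_cast h
    rw [min_eq_left h', min_eq_left (by linarith)]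
    linarith
  · have h' : (n : ℝ) + 1 ≤ k + 1 := by exact_mod_cast h
    rw [min_eq_right h']
    rcases le_total (k : ℝ) (n + 1) with h2 | h2
    · rw [min_eq_left h2]; linarith
    · rw [min_eq_right h2]; linarith

lemma exists_tendsto_grid {σ r : ℝ≥0} (hr : r ≤ σ) :
    ∃ k : ℕ → ℕ, Tendsto (fun n => grid σ (n, k n)) atTop (𝓝 r) := by
  rcases eq_or_ne σ 0 with rfl | hσ
  · exact ⟨fun _ => 0, by simp [grid, le_antisymm hr zero_le]⟩
  have hσ' : (0 : ℝ) < σ := by positivity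
  refine ⟨fun n => ⌊(r / σ : ℝ) * ((n : ℝ) + 1)⌋₊, ?_⟩
  have hrs : (r / σ : ℝ) ≤ 1 := div_le_one_of_le₀ (by exact_mod_cast hr) hσ'.le
  have h1 : Tendsto (fun n : ℕ => ((⌊(r / σ : ℝ) * ((n : ℝ) + 1)⌋₊ : ℕ) : ℝ) / ((n : ℝ) + 1)) atTop
      (𝓝 (r / σ)) :=
    (tendsto_nat_floor_mul_div_atTop (by positivity)).comp
      (tendsto_atTop_add_const_right _ 1 tendsto_natCast_atTop_atTop)
  rw [← NNReal.tendsto_coe]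
  have h2 := h1.const_mul (σ : ℝ)
  rw [mul_div_cancel₀ _ hσ'.ne'] at h2
  refine h2.congr fun n => ?_
  have h3 : ⌊(r / σ : ℝ) * ((n : ℝ) + 1)⌋₊ ≤ n + 1 := by
    apply Nat.floor_le_of_le
    push_cast
    nlinarith
  simp only [grid, min_eq_left h3]
  push_cast
  rfl

lemma eventually_exists_grid_pos {f : ℝ≥0 → ℝ} (hf : Continuous f) {σ r : ℝ≥0} (hr : r ≤ σ)
    (hfr : 0 < f r) : ∀ᶠ n in atTop, ∃ k, 0 < f (grid σ (n, k)) := by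
  obtain ⟨k, hk⟩ := exists_tendsto_grid hr
  filter_upwards [((hf.tendsto r).comp hk).eventually_const_lt hfr] with n hn
  exact ⟨k n, hn⟩

/-- A strict violation persists at nearby grid points. Reducing to countably many times is what
makes the barrier events null measurable. -/
lemma forall_le_iff_forall_grid {f : ℝ≥0 → ℝ} (hf : Continuous f) (σ : ℝ≥0) :
    (∀ r ≤ σ, f r ≤ 0) ↔ ∀ i, f (grid σ i) ≤ 0 := by
  refine ⟨fun h i => h _ (grid_le σ i), fun h r hr => ?_⟩
  by_contra! hc
  obtain ⟨n, k, hk⟩ := (eventually_exists_grid_pos hf hr hc).exists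
  exact (h (n, k)).not_gt hk

/-- The oscillation of a continuous function between consecutive grid points tends to `0`. -/
lemma eventually_grid_osc {f : ℝ≥0 → ℝ} (hf : Continuous f) (σ : ℝ≥0) {ε : ℝ} (hε : 0 < ε) :
    ∀ᶠ n in atTop, ∀ k, |f (grid σ (n, k + 1)) - f (grid σ (n, k))| < ε := by
  have huc : UniformContinuousOn f (Set.Icc 0 σ) :=
    isCompact_Icc.uniformContinuousOn_of_continuous hf.continuousOn
  obtain ⟨δ, hδ, h⟩ := Metric.uniformContinuousOn_iff.1 huc ε hε
  have h1 : Tendsto (fun n : ℕ => (σ : ℝ) * (1 / ((n : ℝ) + 1))) atTop (𝓝 0) := by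
    simpa using tendsto_one_div_add_atTop_nhds_zero_nat.const_mul (σ : ℝ)
  filter_upwards [h1.eventually_lt_const hδ] with n hn k
  rw [← Real.dist_eq]
  refine h _ ⟨zero_le, grid_le _ _⟩ _ ⟨zero_le, grid_le _ _⟩ ?_
  rw [NNReal.dist_eq, abs_of_nonneg]
  · exact (grid_succ_sub_le σ n k).trans_lt hn
  · exact sub_nonneg.2 (by exact_mod_cast grid_mono σ n (Nat.le_succ k))

end Grid

/-! ### Crossing paths cancel in expectation -/

section Crossing

variable {Ω : Type*} [MeasurableSpace Ω] {P : Measure Ω} {W : ℝ≥0 → Ω → ℝ}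

/-- The process stays below the line `r ↦ a + c * r` at all grid points of `[0, σ]`. -/
def stayBelow (W : ℝ≥0 → Ω → ℝ) (a c : ℝ) (σ : ℝ≥0) : Set Ω :=
  {ω | ∀ i, W (grid σ i) ω ≤ a + c * grid σ i}

/-- The process stays below the line `r ↦ a + c * r` at the first `k` points of the `n`-th grid. -/
def stayBelowGrid (W : ℝ≥0 → Ω → ℝ) (a c : ℝ) (σ : ℝ≥0) (n k : ℕ) : Set Ω :=
  {ω | ∀ j < k, W (grid σ (n, j)) ω ≤ a + c * grid σ (n, j)}

lemma nullMeasurableSet_stayBelow (hW : ∀ t, AEMeasurable (W t) P) (a c : ℝ) (σ : ℝ≥0) :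
    NullMeasurableSet (stayBelow W a c σ) P := by
  simp only [stayBelow, Set.ofPred_forall]
  exact .iInter fun i => nullMeasurableSet_le (hW _) aemeasurable_const

lemma nullMeasurableSet_stayBelowGrid (hW : ∀ t, AEMeasurable (W t) P) (a c : ℝ) (σ : ℝ≥0)
    (n k : ℕ) : NullMeasurableSet (stayBelowGrid W a c σ n k) P := by
  simp only [stayBelowGrid, Set.ofPred_forall]
  exact .iInter fun i => .iInter fun _ => nullMeasurableSet_le (hW _) aemeasurable_const

omit [MeasurableSpace Ω] in
lemma stayBelowGrid_succ (a c : ℝ) (σ : ℝ≥0) (n k : ℕ) :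
    stayBelowGrid W a c σ n (k + 1) =
      stayBelowGrid W a c σ n k ∩ {ω | W (grid σ (n, k)) ω ≤ a + c * grid σ (n, k)} := by
  ext ω
  simp only [stayBelowGrid, Set.mem_ofPred_eq, Set.mem_inter_iff, Nat.lt_succ_iff_lt_or_eq]
  grind

/-- The Markov property at the `k`-th grid point, on the event of a first crossing there. -/
lemma setIntegral_first_crossing (hW : IsPreBrownianReal W P) (a c : ℝ) (σ : ℝ≥0) (n k : ℕ)
    {G : ℝ → ℝ} (hG : Measurable G) {C : ℝ} (hC : ∀ x, |G x| ≤ C) :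
    ∫ ω in stayBelowGrid W a c σ n k \ stayBelowGrid W a c σ n (k + 1), G (W σ ω) ∂P =
      ∫ ω in stayBelowGrid W a c σ n k \ stayBelowGrid W a c σ n (k + 1),
        ∫ z, G (W (grid σ (n, k)) ω + z) ∂(gaussianReal 0 (σ - grid σ (n, k))) ∂P := by
  have := hW.isGaussianProcess.isProbabilityMeasure
  have hm := hW.aemeasurable
  set t := grid σ (n, k) with ht
  have htσ : t ≤ σ := grid_le _ _
  -- Freezing the index at `k` makes `U` a function of the path up to time `t`, hence independent of
  -- the later increment `Z`.
  let U : Ω → ℕ → ℝ := fun ω j => W (grid σ (n, min j k)) ω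
  let Z : Ω → ℝ := fun ω => W σ ω - W t ω
  have hU : AEMeasurable U P := aemeasurable_pi_lambda _ fun j => hm _
  have hZ : AEMeasurable Z P := (hm σ).sub (hm t)
  have hUZ : IndepFun U Z P := by
    have h1 := (hW.indepFun_shift t).symm
    have h2 := h1.comp (φ := fun (w : Set.Iic t → ℝ) (j : ℕ) =>
        w ⟨grid σ (n, min j k), grid_mono σ n (min_le_right j k)⟩)
      (ψ := fun w : ℝ≥0 → ℝ => w (σ - t)) (by fun_prop)
      (measurable_pi_apply (X := fun _ : ℝ≥0 => ℝ) (σ - t))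
    have hZeq : Z = (fun w : ℝ≥0 → ℝ => w (σ - t)) ∘ fun ω r => W (t + r) ω - W t ω := by
      ext ω
      simp [Z, add_tsub_cancel_of_le htσ]
    rw [hZeq]
    exact h2
  have hZlaw : P.map Z = gaussianReal 0 (σ - t) := by
    have hd : nndist (σ : ℝ) (t : ℝ) = σ - t := by
      ext
      rw [coe_nndist, Real.dist_eq, NNReal.coe_sub htσ,
        abs_of_nonneg (sub_nonneg.2 (by exact_mod_cast htσ))]
    rw [← hd]
    exact (hW.hasLaw_sub σ t).map_eq
  set E := stayBelowGrid W a c σ n k \ stayBelowGrid W a c σ n (k + 1) with hE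
  have hEm : NullMeasurableSet E P :=
    (nullMeasurableSet_stayBelowGrid hm a c σ n k).diff
      (nullMeasurableSet_stayBelowGrid hm a c σ n (k + 1))
  let S : Set (ℕ → ℝ) := {u | (∀ j < k, u j ≤ a + c * grid σ (n, j)) ∧ ¬ u k ≤ a + c * t}
  have hS : MeasurableSet S := by
    refine MeasurableSet.inter (s₁ := {u : ℕ → ℝ | ∀ j < k, u j ≤ a + c * grid σ (n, j)})
      (s₂ := {u : ℕ → ℝ | u k ≤ a + c * t}ᶜ) ?_ ?_
    · simp only [Set.ofPred_forall]
      exact .iInter fun i => .iInter fun _ =>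
        measurableSet_le (measurable_pi_apply _) measurable_const
    · exact (measurableSet_le (measurable_pi_apply _) measurable_const).compl
  have hES : ∀ ω, ω ∈ E ↔ U ω ∈ S := by
    intro ω
    rw [hE, stayBelowGrid_succ]
    simp only [stayBelowGrid, Set.mem_sdiff, Set.mem_inter_iff, Set.mem_ofPred_eq, S, U, min_self]
    have : ∀ j < k, min j k = j := fun j hj => min_eq_left hj.le
    constructor
    · rintro ⟨h1, h2⟩
      refine ⟨fun j hj => by rw [this j hj]; exact h1 j hj, fun h3 => h2 ⟨h1, h3⟩⟩
    · rintro ⟨h1, h2⟩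
      exact ⟨fun j hj => by have := h1 j hj; rwa [min_eq_left hj.le] at this, fun h3 => h2 h3.2⟩
  let f : (ℕ → ℝ) × ℝ → ℝ := fun x => S.indicator (fun _ => (1 : ℝ)) x.1 * G (x.1 k + x.2)
  have hf : Measurable f := by
    have : Measurable (S.indicator (fun _ => (1 : ℝ))) := measurable_const.indicator hS
    fun_prop
  have hfC : ∀ x, |f x| ≤ C := by
    intro x
    simp only [f, abs_mul]
    have hC0 : 0 ≤ C := (abs_nonneg _).trans (hC 0)
    by_cases hx : x.1 ∈ S
    · simp [hx, hC]
    · simp [hx, hC0]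
  have key := hUZ.integral_prodMk hU hZ hf hfC
  rw [hZlaw] at key
  rw [← integral_indicator₀ hEm, ← integral_indicator₀ hEm]
  convert key using 2
  · ext ω
    by_cases hω : ω ∈ E
    · have := (hES ω).1 hω
      simp [f, hω, this, U, Z, ← ht]
    · have : U ω ∉ S := fun h => hω ((hES ω).2 h)
      simp [f, hω, this]
  · ext ω
    by_cases hω : ω ∈ E
    · have := (hES ω).1 hω
      simp [f, hω, this, U, ← ht]
    · have : U ω ∉ S := fun h => hω ((hES ω).2 h)
      simp [f, hω, this]

/-- Reflection argument: if the heat evolution of `G` vanishes on the line, then the paths which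
cross the line do not contribute to the expectation of `G (W σ)`. -/
theorem setIntegral_stayBelow_eq_integral (hW : IsBrownianReal W P) {a c : ℝ} (ha : 0 < a)
    (σ : ℝ≥0) {G : ℝ → ℝ} (hG : UniformContinuous G) {C : ℝ} (hC : ∀ x, |G x| ≤ C)
    (hzero : ∀ v ≤ σ, ∫ z, G (a + c * ((σ : ℝ) - v) + z) ∂(gaussianReal 0 v) = 0) :
    ∫ ω in stayBelow W a c σ, G (W σ ω) ∂P = ∫ ω, G (W σ ω) ∂P := by
  have := hW.isGaussianProcess.isProbabilityMeasure
  have hm := hW.aemeasurable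
  have hC0 : 0 ≤ C := (abs_nonneg _).trans (hC 0)
  have hGm : Measurable G := hG.continuous.measurable
  have hint : ∀ s : Set Ω, IntegrableOn (fun ω => G (W σ ω)) s P := fun s =>
    (Integrable.of_bound (hGm.comp_aemeasurable (hm σ)).aestronglyMeasurable C
      (ae_of_all _ fun ω => hC _)).integrableOn
  -- the expectations over the paths below the line at grid points converge
  have hlim : Tendsto (fun n => ∫ ω in stayBelowGrid W a c σ n (n + 2), G (W σ ω) ∂P) atTop
      (𝓝 (∫ ω in stayBelow W a c σ, G (W σ ω) ∂P)) := by
    have hN := nullMeasurableSet_stayBelowGrid hm a c σ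
    simp_rw [← integral_indicator₀ (nullMeasurableSet_stayBelow hm a c σ),
      ← integral_indicator₀ (hN _ _)]
    refine tendsto_integral_of_dominated_convergence (fun _ => C) (fun n => ?_)
      (integrable_const _) (fun n => ae_of_all _ fun ω => ?_) ?_
    · exact ((hGm.comp_aemeasurable (hm σ)).aestronglyMeasurable).indicator₀ (hN _ _)
    · by_cases hω : ω ∈ stayBelowGrid W a c σ n (n + 2) <;> simp [hω, hC, hC0]
    · filter_upwards [hW.cont] with ω hω
      by_cases h : ω ∈ stayBelow W a c σ
      · refine tendsto_const_nhds.congr fun n => ?_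
        have : ω ∈ stayBelowGrid W a c σ n (n + 2) := fun j _ => h (n, j)
        simp [h, this]
      · have h' := h
        simp only [stayBelow, Set.mem_ofPred_eq, not_forall, not_le] at h'
        obtain ⟨i, hi⟩ := h'
        have hf : Continuous fun r : ℝ≥0 => W r ω - (a + c * r) := by fun_prop
        refine tendsto_const_nhds.congr' ?_
        filter_upwards [eventually_exists_grid_pos hf (grid_le σ i) (sub_pos.2 hi)] with n hn
        have : ω ∉ stayBelowGrid W a c σ n (n + 2) := by
          intro hmem
          obtain ⟨k, hk⟩ := hn
          -- The `n`-th grid has the `n + 2` points `0, ..., n + 1`; larger indices repeat the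
          -- endpoint `σ`.
          rcases lt_or_ge k (n + 2) with h1 | h1
          · linarith [hmem k h1]
          · have h2 : grid σ (n, k) = grid σ (n, n + 1) := by
              simp [grid, min_eq_right (show n + 1 ≤ k by omega)]
            rw [h2] at hk
            linarith [hmem (n + 1) (by omega)]
        simp [h, this]
  refine tendsto_nhds_unique hlim ?_
  rw [Metric.tendsto_nhds]
  intro ε' hε'
  set ε := ε' / 2 with hε_def
  have hε : 0 < ε := by positivity
  obtain ⟨δ, hδ, hGδ⟩ := Metric.uniformContinuous_iff.1 hG ε hε
  -- Relative to `D` the line is the constant level `a`, so the overshoot at a first crossing is at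
  -- most one grid increment of `D`. `A n` is the event that some increment is large.
  let D : ℝ≥0 → Ω → ℝ := fun r ω => W r ω - c * r
  let A : ℕ → Set Ω := fun n => {ω | ∃ k, δ ≤ |D (grid σ (n, k + 1)) ω - D (grid σ (n, k)) ω|}
  have hDm : ∀ r, AEMeasurable (D r) P := fun r => (hm r).sub aemeasurable_const
  have hA : ∀ n, NullMeasurableSet (A n) P := fun n => by
    simp only [A, Set.ofPred_exists]
    exact .iUnion fun k => nullMeasurableSet_le aemeasurable_const
      (continuous_abs.measurable.comp_aemeasurable ((hDm _).sub (hDm _)))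
  have hAlim : Tendsto (fun n => P.real (A n)) atTop (𝓝 0) := by
    have h1 : ∀ n, P.real (A n) = ∫ ω, (A n).indicator (fun _ => (1 : ℝ)) ω ∂P := fun n => by
      rw [integral_indicator₀ (hA n)]; simp
    simp_rw [h1]
    rw [← integral_zero Ω ℝ (μ := P)]
    refine tendsto_integral_of_dominated_convergence (fun _ => 1)
      (fun n => aestronglyMeasurable_const.indicator₀ (hA n))
      (integrable_const _) (fun n => ae_of_all _ fun ω => ?_) ?_
    · by_cases hω : ω ∈ A n <;> simp [hω]
    · filter_upwards [hW.cont] with ω hω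
      have hf : Continuous fun r : ℝ≥0 => D r ω := by simp only [D]; fun_prop
      refine tendsto_const_nhds.congr' ?_
      filter_upwards [eventually_grid_osc hf σ hδ] with n hn
      have : ω ∉ A n := fun ⟨k, hk⟩ => (hn k).not_ge hk
      simp [this]
  have hAlim' : Tendsto (fun n => ε + C * P.real (A n)) atTop (𝓝 (ε + C * 0)) :=
    (hAlim.const_mul C).const_add ε
  filter_upwards [hAlim'.eventually_lt_const (show ε + C * 0 < ε' by simp [hε_def, hε'])] with n hn
  set F := stayBelowGrid W a c σ n with hF
  have hFm : ∀ k, NullMeasurableSet (F k) P := nullMeasurableSet_stayBelowGrid hm a c σ n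
  -- Pointwise error bound: `ε` from uniform continuity when the overshoot is small, and the crude
  -- bound `C` in addition on `A n`.
  let ψ : Ω → ℝ := fun ω => ε + C * (A n).indicator (fun _ => (1 : ℝ)) ω
  have hψ0 : ∀ ω, 0 ≤ ψ ω := fun ω => by
    by_cases hω : ω ∈ A n <;> simp [ψ, hω] <;> positivity
  have hindint : Integrable ((A n).indicator (fun _ => (1 : ℝ))) P :=
    (integrable_const 1).indicator₀ (hA n)
  have hψi : Integrable ψ P := (integrable_const _).add (hindint.const_mul C)
  have hψint : ∫ ω, ψ ω ∂P = ε + C * P.real (A n) := by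
    simp only [ψ]
    rw [integral_add (integrable_const _) (hindint.const_mul C), integral_const_mul,
      integral_indicator₀ (hA n)]
    simp
  have hstep : ∀ k, |∫ ω in F k \ F (k + 1), G (W σ ω) ∂P| ≤ ∫ ω in F k \ F (k + 1), ψ ω ∂P := by
    intro k
    have hE : NullMeasurableSet (F k \ F (k + 1)) P := (hFm k).diff (hFm (k + 1))
    rw [hF, setIntegral_first_crossing hW.toIsPreBrownianReal a c σ n k hGm hC, ← hF,
      ← Real.norm_eq_abs]
    refine norm_integral_le_of_norm_le hψi.integrableOn ?_
    rw [ae_restrict_iff'₀ hE]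
    filter_upwards [hW.eval_zero_ae_eq_zero] with ω h0 hω
    rw [hF, stayBelowGrid_succ] at hω
    have hcross : a + c * grid σ (n, k) < W (grid σ (n, k)) ω := by
      by_contra! hc
      exact hω.2 ⟨hω.1, hc⟩
    have hbound : ∀ w v, ‖∫ z, G (w + z) ∂(gaussianReal 0 v)‖ ≤ C := fun w v =>
      (norm_integral_le_of_norm_le_const (ae_of_all _ fun z => hC _)).trans (by simp)
    by_cases hωA : ω ∈ A n
    · simp only [ψ, hωA, Set.indicator_of_mem, mul_one]
      exact (hbound _ _).trans (by linarith)
    simp only [ψ, hωA, not_false_eq_true, Set.indicator_of_notMem, mul_zero, add_zero]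
    -- No crossing can occur at index `0`, since the path starts at `0 < a`; otherwise index `j` is
    -- the last one known to lie below the line.
    obtain _ | j := k
    · rw [grid_zero, h0] at hcross
      simp at hcross
      linarith
    have hj : W (grid σ (n, j)) ω ≤ a + c * grid σ (n, j) := hω.1 j (Nat.lt_succ_self j)
    have hosc : |D (grid σ (n, j + 1)) ω - D (grid σ (n, j)) ω| < δ := by
      by_contra! hc
      exact hωA ⟨j, hc⟩
    simp only [D] at hosc
    set t := grid σ (n, j + 1) with ht
    have htσ : t ≤ σ := grid_le _ _
    have hz := hzero (σ - t) tsub_le_self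
    rw [NNReal.coe_sub htσ, sub_sub_cancel] at hz
    have hi : ∀ w, Integrable (fun z => G (w + z)) (gaussianReal 0 (σ - t)) := fun w =>
      Integrable.of_bound (hGm.comp (measurable_const_add w)).aestronglyMeasurable C
        (ae_of_all _ fun z => hC _)
    -- Started exactly on the line the expectation is zero, so only the effect of moving the
    -- starting point by the overshoot remains.
    have hdiff : ∫ z, G (W t ω + z) ∂(gaussianReal 0 (σ - t)) =
        ∫ z, (G (W t ω + z) - G (a + c * t + z)) ∂(gaussianReal 0 (σ - t)) := by
      rw [integral_sub (hi _) (hi _), hz, sub_zero]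
    rw [hdiff]
    refine (norm_integral_le_of_norm_le_const (C := ε) (ae_of_all _ fun z => ?_)).trans (by simp)
    rw [← dist_eq_norm]
    refine (hGδ ?_).le
    rw [dist_add_right, Real.dist_eq, abs_of_pos (by linarith)]
    linarith [(abs_lt.1 hosc).2]
  -- The complement is the disjoint union of the first-crossing events, so the errors add up to one
  -- integral of `ψ`, independently of the number of grid points.
  have hind : ∀ k, |∫ ω in (F k)ᶜ, G (W σ ω) ∂P| ≤ ∫ ω in (F k)ᶜ, ψ ω ∂P := by
    intro k
    induction k with
    | zero => simp [hF, stayBelowGrid]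
    | succ k ih =>
      have hsub : F (k + 1) ⊆ F k := by rw [hF, stayBelowGrid_succ]; exact Set.inter_subset_left
      have hun : (F (k + 1))ᶜ = (F k)ᶜ ∪ (F k \ F (k + 1)) := by
        ext ω
        have := @hsub ω
        simp only [Set.mem_compl_iff, Set.mem_union, Set.mem_sdiff]
        tauto
      have hdis : AEDisjoint P (F k)ᶜ (F k \ F (k + 1)) :=
        (Set.disjoint_left.2 fun ω (h1 : ω ∉ F k) h2 => h1 h2.1).aedisjoint
      rw [hun, setIntegral_union₀ hdis ((hFm k).diff (hFm (k + 1))) (hint _) (hint _),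
        setIntegral_union₀ hdis ((hFm k).diff (hFm (k + 1))) hψi.integrableOn hψi.integrableOn]
      exact (abs_add_le _ _).trans (add_le_add ih (hstep k))
  have hsplit := integral_add_compl₀ (hFm (n + 2)) (integrableOn_univ.1 (hint Set.univ))
  rw [Real.dist_eq, ← hsplit, sub_add_cancel_left, abs_neg]
  calc |∫ ω in (F (n + 2))ᶜ, G (W σ ω) ∂P| ≤ ∫ ω in (F (n + 2))ᶜ, ψ ω ∂P := hind _
    _ ≤ ∫ ω, ψ ω ∂P := setIntegral_le_integral hψi (ae_of_all _ hψ0)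
    _ < ε' := by rw [hψint]; exact hn

end Crossing

/-! ### Odd reflection with drift and the image density -/

section Reflection

/-- The odd reflection of `g` at `b`, weighted for the drift `c`. -/
def reflect (c b : ℝ) (g : ℝ → ℝ) (y : ℝ) : ℝ := g y - Real.exp (2 * c * (y - b)) * g (2 * b - y)

lemma continuous_reflect {c b : ℝ} {g : ℝ → ℝ} (hg : Continuous g) : Continuous (reflect c b g) := by
  unfold reflect; fun_prop

lemma hasCompactSupport_reflect {c b : ℝ} {g : ℝ → ℝ} (hg : HasCompactSupport g) :
    HasCompactSupport (reflect c b g) := by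
  have h1 : HasCompactSupport fun y => g (2 * b - y) :=
    hg.comp_homeomorph (Homeomorph.subLeft (2 * b))
  exact hg.sub (h1.mul_left (f := fun y => Real.exp (2 * c * (y - b))))

/-- With time `v` left, the line that ends at height `b` is at `b - c * v`. Recentring at `b` tilts
the Gaussian density by `exp (-c u)`; the weight `exp (2 c u)` in `reflect` is the one that turns
the integrand into an odd function of `u`. -/
lemma integral_reflect_eq_zero (c b : ℝ) (g : ℝ → ℝ) (v : ℝ≥0) :
    ∫ z, reflect c b g (b - c * v + z) ∂(gaussianReal 0 v) = 0 := by
  rcases eq_or_ne v 0 with rfl | hv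
  · simp [reflect, two_mul]
  rw [integral_gaussianReal_eq_integral_smul hv]
  simp only [smul_eq_mul]
  rw [← integral_add_right_eq_self (μ := volume) _ (c * (v : ℝ))]
  set F : ℝ → ℝ := fun u => gaussianPDFReal 0 v (u + c * v) *
    reflect c b g (b - c * v + (u + c * v)) with hF
  have hodd : ∀ u, F (-u) = -F u := by
    intro u
    have hv' : (v : ℝ) ≠ 0 := by exact_mod_cast hv
    have e1 : ∀ u, gaussianPDFReal 0 v (u + c * v) =
        gaussianPDFReal 0 v u * Real.exp (-(c * u)) * Real.exp (-(c ^ 2 * v / 2)) := by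
      intro u
      simp only [gaussianPDFReal, mul_assoc, ← Real.exp_add]
      congr 2
      field_simp
      ring
    have e2 : gaussianPDFReal 0 v (-u) = gaussianPDFReal 0 v u := by
      simp [gaussianPDFReal]
    have e3 : Real.exp (2 * c * (b - c * v + (u + c * v) - b)) =
        Real.exp (c * u) * Real.exp (c * u) := by
      rw [← Real.exp_add]; ring_nf
    have e4 : Real.exp (2 * c * (b - c * v + (-u + c * v) - b)) =
        Real.exp (-(c * u)) * Real.exp (-(c * u)) := by
      rw [← Real.exp_add]; ring_nf
    have e5 : Real.exp (-(c * u)) * Real.exp (c * u) = 1 := by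
      rw [← Real.exp_add]; simp
    have e6 : 2 * b - (b - c * v + (u + c * v)) = b - u := by ring
    have e7 : 2 * b - (b - c * v + (-u + c * v)) = b + u := by ring
    have e8 : b - c * v + (u + c * v) = b + u := by ring
    have e9 : b - c * v + (-u + c * v) = b - u := by ring
    have e10 : Real.exp (-(c * -u)) = Real.exp (c * u) := by ring_nf
    simp only [hF, reflect, e1, e2, e3, e4, e6, e7]
    rw [e8, e9, e10]
    linear_combination (-(gaussianPDFReal 0 v u) * Real.exp (-(c ^ 2 * v / 2))) *
      ((g (b + u)) * Real.exp (-(c * u)) + g (b - u) * Real.exp (c * u)) * e5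
  have h1 : ∫ u, F u = -∫ u, F u := by
    rw [← integral_neg, ← integral_neg_eq_self]
    exact integral_congr_ae (ae_of_all _ hodd)
  change ∫ u, F u = 0
  linarith

/-- The density at the terminal time `σ` of the law of a Brownian motion which stays below the
line `r ↦ a + c * r`. -/
def stayBelowDensity (a c : ℝ) (σ : ℝ≥0) (y : ℝ) : ℝ :=
  gaussianPDFReal 0 σ y - Real.exp (-(2 * a * c)) * gaussianPDFReal (2 * a) σ y

/-- The second factor is the probability that a Brownian bridge ending at `y` below the line does
not cross it. This form exhibits the sign of the density and matches the bracket in the final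
integrand. -/
lemma stayBelowDensity_eq {a c : ℝ} {σ : ℝ≥0} (hσ : σ ≠ 0) (y : ℝ) :
    stayBelowDensity a c σ y =
      gaussianPDFReal 0 σ y * (1 - Real.exp (-(2 * a * (a + c * σ - y) / σ))) := by
  have hσ' : (σ : ℝ) ≠ 0 := by exact_mod_cast hσ
  rw [stayBelowDensity, mul_sub, mul_one]
  congr 1
  simp only [gaussianPDFReal]
  rw [mul_left_comm, mul_assoc (√_)⁻¹, ← Real.exp_add, ← Real.exp_add]
  congr 2
  field_simp
  ring

lemma continuous_stayBelowDensity (a c : ℝ) (σ : ℝ≥0) : Continuous (stayBelowDensity a c σ) := by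
  unfold stayBelowDensity gaussianPDFReal
  fun_prop

lemma integrable_stayBelowDensity (a c : ℝ) (σ : ℝ≥0) : Integrable (stayBelowDensity a c σ) :=
  (integrable_gaussianPDFReal _ _).sub ((integrable_gaussianPDFReal _ _).const_mul _)

lemma stayBelowDensity_nonneg {a c : ℝ} (ha : 0 < a) {σ : ℝ≥0} (hσ : σ ≠ 0) {y : ℝ}
    (hy : y ≤ a + c * σ) : 0 ≤ stayBelowDensity a c σ y := by
  rw [stayBelowDensity_eq hσ]
  refine mul_nonneg (gaussianPDFReal_nonneg _ _ _) (sub_nonneg.2 (Real.exp_le_one_iff.2 ?_))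
  have : 0 ≤ a + c * σ - y := by linarith
  rw [neg_nonpos]
  positivity

/-- Method of images: moving the reflection `y ↦ 2 * b - y` from `g` to the Gaussian density yields
a source at `2 * a` of weight `exp (-2 a c)`. -/
lemma integral_reflect_gaussianReal {a c : ℝ} {σ : ℝ≥0} (hσ : σ ≠ 0) {g : ℝ → ℝ}
    (hg : Continuous g) (hgc : HasCompactSupport g) :
    ∫ y, reflect c (a + c * σ) g y ∂(gaussianReal 0 σ) = ∫ y, g y * stayBelowDensity a c σ y := by
  have hσ' : (σ : ℝ) ≠ 0 := by exact_mod_cast hσ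
  set b := a + c * σ with hb
  have hpc : ∀ μ, Continuous (gaussianPDFReal μ σ) := fun μ => by
    unfold gaussianPDFReal; fun_prop
  have i1 : Integrable fun y => gaussianPDFReal 0 σ y * g y :=
    ((hpc 0).mul hg).integrable_of_hasCompactSupport hgc.mul_left
  have i2 : Integrable fun y => gaussianPDFReal 0 σ y *
      (Real.exp (2 * c * (y - b)) * g (2 * b - y)) := by
    have h1 : HasCompactSupport fun y => g (2 * b - y) :=
      hgc.comp_homeomorph (Homeomorph.subLeft (2 * b))
    refine Continuous.integrable_of_hasCompactSupport (by have := hpc 0; fun_prop) ?_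
    exact (h1.mul_left (f := fun y => Real.exp (2 * c * (y - b)))).mul_left
  have i3 : Integrable fun y => g y * (Real.exp (-(2 * a * c)) * gaussianPDFReal (2 * a) σ y) :=
    (hg.mul (continuous_const.mul (hpc _))).integrable_of_hasCompactSupport hgc.mul_right
  rw [integral_gaussianReal_eq_integral_smul hσ]
  simp only [smul_eq_mul, reflect, stayBelowDensity, mul_sub (gaussianPDFReal _ _ _),
    mul_sub (g _)]
  rw [integral_sub i1 i2, integral_sub (by simpa only [mul_comm] using i1) i3]
  congr 1
  · simp only [mul_comm]
  rw [← integral_sub_left_eq_self _ volume (2 * b)]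
  refine integral_congr_ae (ae_of_all _ fun y => ?_)
  simp only [sub_sub_cancel]
  rw [← mul_assoc, mul_comm]
  congr 1
  simp only [gaussianPDFReal]
  rw [mul_assoc, mul_left_comm (Real.exp (-(2 * a * c))), ← Real.exp_add, ← Real.exp_add]
  congr 2
  rw [hb]
  field_simp
  ring

end Reflection

/-! ### Endpoint law below a line and the Bachelier-Lévy formula -/

section Law

variable {Ω : Type*} [MeasurableSpace Ω] {P : Measure Ω} {W : ℝ≥0 → Ω → ℝ}

lemma setIntegral_stayBelow_eq_integral_density (hW : IsBrownianReal W P) {a c : ℝ} (ha : 0 < a)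
    {σ : ℝ≥0} (hσ : σ ≠ 0) {g : ℝ → ℝ} (hg : Continuous g) (hgc : HasCompactSupport g)
    (hg0 : ∀ y, a + c * σ ≤ y → g y = 0) :
    ∫ ω in stayBelow W a c σ, g (W σ ω) ∂P = ∫ y, g y * stayBelowDensity a c σ y := by
  have hc := continuous_reflect (c := c) (b := a + c * σ) hg
  have hcc := hasCompactSupport_reflect (c := c) (b := a + c * σ) hgc
  obtain ⟨C, hC⟩ := hcc.exists_bound_of_continuous hc
  have h1 := setIntegral_stayBelow_eq_integral hW ha (c := c) σ
    (hcc.uniformContinuous_of_continuous hc) hC (fun v hv => by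
      have := integral_reflect_eq_zero c (a + c * σ) g v
      convert this using 4
      ring)
  have hlaw := hW.hasLaw_eval σ
  rw [← integral_map hlaw.aemeasurable hc.aestronglyMeasurable (f := reflect c (a + c * σ) g),
    hlaw.map_eq, integral_reflect_gaussianReal hσ hg hgc] at h1
  rw [← h1]
  refine setIntegral_congr_fun₀ (nullMeasurableSet_stayBelow hW.aemeasurable a c σ) fun ω hω => ?_
  have := hω (0, 1)
  rw [show grid σ (0, 1) = σ from grid_last σ 0] at this
  -- The endpoint is at or below the line, so its mirror image is at or above it, where `g`
  -- vanishes.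
  simp [reflect, hg0 (2 * (a + c * σ) - W σ ω) (by linarith)]

/-- The law of `W σ` on the event that `W` stays below the line `r ↦ a + c * r` on `[0, σ]`. -/
theorem map_restrict_stayBelow (hW : IsBrownianReal W P) {a c : ℝ} (ha : 0 < a)
    {σ : ℝ≥0} (hσ : σ ≠ 0) :
    (P.restrict (stayBelow W a c σ)).map (W σ) =
      (volume.restrict (Set.Iio (a + c * σ))).withDensity
        fun y => ENNReal.ofReal (stayBelowDensity a c σ y) := by
  have := hW.isGaussianProcess.isProbabilityMeasure
  set b := a + c * σ with hb
  set N := stayBelow W a c σ with hN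
  have hNm : NullMeasurableSet N P := nullMeasurableSet_stayBelow hW.aemeasurable a c σ
  have hWσ := hW.aemeasurable σ
  have hρ := continuous_stayBelowDensity a c σ
  have hρi := integrable_stayBelowDensity a c σ
  have := isFiniteMeasure_withDensity_ofReal (hρi.restrict (s := Set.Iio b)).2
  refine Measure.ext_of_integral_eq_on_compactlySupported fun f => ?_
  rw [integral_map hWσ.restrict (f := fun y => f y) f.continuous.aestronglyMeasurable]
  have hμ : ∫ y, f y ∂((volume.restrict (Set.Iio b)).withDensity
      fun y => ENNReal.ofReal (stayBelowDensity a c σ y)) =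
      ∫ y in Set.Iio b, f y * stayBelowDensity a c σ y := by
    rw [integral_withDensity_eq_integral_toReal_smul (by fun_prop) (by simp)]
    refine setIntegral_congr_fun measurableSet_Iio fun y hy => ?_
    simp only [smul_eq_mul]
    rw [ENNReal.toReal_ofReal (stayBelowDensity_nonneg ha hσ (le_of_lt hy)), mul_comm]
  rw [hμ]
  obtain ⟨C, hC⟩ := f.hasCompactSupport.exists_bound_of_continuous f.continuous
  have hC0 : 0 ≤ C := (norm_nonneg _).trans (hC 0)
  -- cutoff functions increasing to the indicator of `(-∞, b)`
  let χ : ℕ → ℝ → ℝ := fun n y => min 1 ((n : ℝ) * max (b - y) 0)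
  have hχc : ∀ n, Continuous (χ n) := fun n => by simp only [χ]; fun_prop
  have hχ0 : ∀ n y, 0 ≤ χ n y := fun n y => le_min zero_le_one (by positivity)
  have hχ1 : ∀ n y, |χ n y| ≤ 1 := fun n y => by
    rw [abs_of_nonneg (hχ0 n y)]; exact min_le_left _ _
  have hχlim : ∀ y < b, Tendsto (fun n => χ n y) atTop (𝓝 1) := by
    intro y hy
    have h0 : 0 < b - y := sub_pos.2 hy
    have h1 : Tendsto (fun n : ℕ => (n : ℝ) * max (b - y) 0) atTop atTop :=
      tendsto_natCast_atTop_atTop.atTop_mul_const (lt_max_of_lt_left h0)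
    refine tendsto_const_nhds.congr' ?_
    filter_upwards [h1.eventually_ge_atTop 1] with n hn
    exact (min_eq_left hn).symm
  have hχz : ∀ n y, b ≤ y → χ n y = 0 := fun n y hy => by
    simp only [χ]
    rw [max_eq_right (by linarith), mul_zero]
    exact min_eq_right zero_le_one
  have heq : ∀ n, ∫ ω in N, f (W σ ω) * χ n (W σ ω) ∂P =
      ∫ y, f y * χ n y * stayBelowDensity a c σ y := fun n =>
    setIntegral_stayBelow_eq_integral_density hW ha hσ (g := fun y => f y * χ n y)
      (f.continuous.mul (hχc n)) f.hasCompactSupport.mul_right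
      (fun y hy => by simp [hχz n y hy])
  have hfχ : ∀ n y, |f y * χ n y| ≤ C := fun n y => by
    rw [abs_mul]
    calc |f y| * |χ n y| ≤ C * 1 := by
          gcongr
          · exact hC y
          · exact hχ1 n y
      _ = C := mul_one C
  -- The cutoffs vanish at `b` itself, so convergence to `1` on the event needs this null set
  -- removed.
  have hne : ∀ᵐ ω ∂P, W σ ω ≠ b := by
    have hlaw := hW.hasLaw_eval σ
    have := nullSingletonClass_gaussianReal (μ := 0) hσ
    have h1 : ∀ᵐ y ∂(P.map (W σ)), y ≠ b := by
      rw [hlaw.map_eq]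
      exact Measure.ae_ne _ b
    exact ae_of_ae_map hWσ h1
  have hlim1 : Tendsto (fun n => ∫ ω in N, f (W σ ω) * χ n (W σ ω) ∂P) atTop
      (𝓝 (∫ ω in N, f (W σ ω) ∂P)) := by
    refine tendsto_integral_of_dominated_convergence (fun _ => C) (fun n => ?_)
      (integrable_const _) (fun n => ae_of_all _ fun ω => hfχ n _) ?_
    · have hc : Continuous fun y => f y * χ n y := f.continuous.mul (hχc n)
      exact (hc.measurable.comp_aemeasurable hWσ.restrict).aestronglyMeasurable
    · rw [ae_restrict_iff'₀ hNm]
      filter_upwards [hne] with ω h1 hω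
      have h2 := hω (0, 1)
      rw [show grid σ (0, 1) = σ from grid_last σ 0] at h2
      simpa using (hχlim _ (lt_of_le_of_ne h2 h1)).const_mul (f (W σ ω))
  have hlim2 : Tendsto (fun n => ∫ y, f y * χ n y * stayBelowDensity a c σ y) atTop
      (𝓝 (∫ y in Set.Iio b, f y * stayBelowDensity a c σ y)) := by
    rw [← integral_indicator measurableSet_Iio]
    refine tendsto_integral_of_dominated_convergence (fun y => C * ‖stayBelowDensity a c σ y‖)
      (fun n => ?_) (hρi.norm.const_mul C) (fun n => ae_of_all _ fun y => ?_)
      (ae_of_all _ fun y => ?_)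
    · exact ((f.continuous.mul (hχc n)).mul hρ).aestronglyMeasurable
    · rw [norm_mul]
      gcongr
      exact hfχ n y
    · by_cases hy : y < b
      · rw [Set.indicator_of_mem (show y ∈ Set.Iio b from hy)]
        simpa using ((hχlim y hy).const_mul (f y)).mul_const (stayBelowDensity a c σ y)
      · rw [Set.indicator_of_notMem (show y ∉ Set.Iio b from hy)]
        simp [hχz _ y (not_lt.1 hy)]
  simp_rw [heq] at hlim1
  exact tendsto_nhds_unique hlim1 hlim2

/-- The **Bachelier-Lévy formula**. -/
theorem measureReal_stayBelow (hW : IsBrownianReal W P) {a : ℝ} (ha : 0 < a) (c : ℝ) (v : ℝ≥0) :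
    P.real (stayBelow W a c v) = bachelierLevy a c (Real.sqrt v) := by
  have := hW.isGaussianProcess.isProbabilityMeasure
  -- Horizon zero, which is the case `s = t` of the theorem: only the starting value `0 < a` is
  -- tested.
  rcases eq_or_ne v 0 with rfl | hv
  · have h1 : ∀ᵐ ω ∂P, ω ∈ stayBelow W a c 0 := by
      filter_upwards [hW.eval_zero_ae_eq_zero] with ω hω i
      simp [grid, hω, ha.le]
    rw [measureReal_def,
      (prob_compl_eq_zero_iff₀ (nullMeasurableSet_stayBelow hW.aemeasurable a c 0)).1 h1]
    simp [bachelierLevy]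
  have hv' : (0 : ℝ) < v := by positivity
  have hs : 0 < Real.sqrt v := Real.sqrt_pos.2 hv'
  have hss : Real.sqrt v * Real.sqrt v = v := Real.mul_self_sqrt hv'.le
  have hΦ : ∀ μ b : ℝ, ∫ y in Set.Iio b, gaussianPDFReal μ v y = Phi ((b - μ) / Real.sqrt v) := by
    intro μ b
    have := nullSingletonClass_gaussianReal (μ := μ) hv
    have hmap : gaussianReal μ v = (gaussianReal 0 1).map fun x => Real.sqrt v * x + μ := by
      have h1 : (gaussianReal 0 1).map (fun x => Real.sqrt v * x) = gaussianReal 0 v := by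
        rw [gaussianReal_map_const_mul]
        congr 1
        · simp
        · ext; simp [sq, hss]
      have h2 := gaussianReal_map_add_const (μ := 0) (v := v) μ
      rw [zero_add, ← h1, Measure.map_map (by fun_prop) (by fun_prop)] at h2
      exact h2.symm
    have h3 : (gaussianReal μ v).real (Set.Iio b) = ∫ y in Set.Iio b, gaussianPDFReal μ v y := by
      rw [measureReal_def, gaussianReal_apply_eq_integral μ hv, ENNReal.toReal_ofReal]
      exact integral_nonneg fun y => gaussianPDFReal_nonneg _ _ _
    rw [← h3, measureReal_congr Iio_ae_eq_Iic, Phi, cdf_eq_real, hmap,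
      map_measureReal_apply (by fun_prop) measurableSet_Iic]
    congr 1
    ext x
    simp only [Set.mem_preimage, Set.mem_Iic]
    rw [le_div_iff₀ hs]
    constructor <;> intro h <;> linarith
  have hlaw := map_restrict_stayBelow hW ha (c := c) hv
  have h1 : P (stayBelow W a c v) =
      (P.restrict (stayBelow W a c v)).map (W v) Set.univ := by
    rw [Measure.map_apply_of_aemeasurable (hW.aemeasurable v).restrict MeasurableSet.univ]
    simp
  have hnn : 0 ≤ᵐ[volume.restrict (Set.Iio (a + c * v))] stayBelowDensity a c v :=
    (ae_restrict_iff' measurableSet_Iio).2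
      (ae_of_all _ fun y hy => stayBelowDensity_nonneg ha hv (le_of_lt hy))
  rw [measureReal_def, h1, hlaw, withDensity_apply _ MeasurableSet.univ, Measure.restrict_univ,
    ← ofReal_integral_eq_lintegral_ofReal (integrable_stayBelowDensity a c v).restrict hnn,
    ENNReal.toReal_ofReal (integral_nonneg_of_ae hnn)]
  simp only [stayBelowDensity]
  rw [integral_sub (integrable_gaussianPDFReal _ _).restrict
    ((integrable_gaussianPDFReal _ _).const_mul _).restrict, integral_const_mul, hΦ, hΦ,
    bachelierLevy, if_neg hs.ne']
  have e1 : (a + c * v - 0) / Real.sqrt v = a / Real.sqrt v + c * Real.sqrt v := by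
    field_simp
    rw [sq, hss]; ring
  have e2 : (a + c * v - 2 * a) / Real.sqrt v = c * Real.sqrt v - a / Real.sqrt v := by
    field_simp
    rw [sq, hss]; ring
  rw [e1, e2, mul_right_comm 2 a c]

end Law

/-! ### A Brownian motion independent of the initial value -/

section Representation

variable {Ω : Type*} [MeasurableSpace Ω] {P : Measure Ω} {B : ℝ≥0 → Ω → ℝ}

/-- The time change `τ ↦ 2 τ / (1 + τ)`, frozen after time `1`. -/
def clock (τ : ℝ≥0) : ℝ≥0 := 2 * min τ 1 / (1 + min τ 1)

/-- The Brownian motion which drives the part of the Slepian process that is independent of its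
initial value; after time `1` it is continued by increments of `B`. -/
def drivingBM (B : ℝ≥0 → Ω → ℝ) (τ : ℝ≥0) (ω : Ω) : ℝ :=
  (1 + min (τ : ℝ) 1) / 2 * slepian B (clock τ) ω - (1 - min (τ : ℝ) 1) / 2 * slepian B 0 ω
    + (B (max τ 1 + 1) ω - B 2 ω)

lemma coe_clock (τ : ℝ≥0) : (clock τ : ℝ) = 2 * min (τ : ℝ) 1 / (1 + min (τ : ℝ) 1) := by
  simp [clock]

lemma clock_le_one (τ : ℝ≥0) : clock τ ≤ 1 := by
  rw [← NNReal.coe_le_coe, coe_clock, NNReal.coe_one]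
  have h1 : 0 ≤ min (τ : ℝ) 1 := le_min τ.2 zero_le_one
  have h2 : min (τ : ℝ) 1 ≤ 1 := min_le_right _ _
  rw [div_le_one (by linarith)]
  linarith

lemma continuous_clock : Continuous clock := by
  unfold clock
  refine Continuous.div (by fun_prop) (by fun_prop) fun τ => by positivity

lemma clock_mono : Monotone clock := by
  intro σ τ h
  rw [← NNReal.coe_le_coe, coe_clock, coe_clock]
  have h1 : 0 ≤ min (σ : ℝ) 1 := le_min σ.2 zero_le_one
  have h2 : min (σ : ℝ) 1 ≤ min (τ : ℝ) 1 := min_le_min_right _ (by exact_mod_cast h)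
  rw [div_le_div_iff₀ (by linarith) (by linarith)]
  linarith

/-- Joint Gaussianity is needed, so that zero covariance with `slepian B 0` gives independence from
the whole driving process. -/
lemma isGaussianProcess_sumElim (hB : IsPreBrownianReal B P) :
    IsGaussianProcess (Sum.elim (fun _ : Unit => slepian B 0) (drivingBM B)) P := by
  refine hB.isGaussianProcess.of_isGaussianProcess ?_
  rintro (_ | τ)
  · exact ⟨{0 + 1, 0},
      { toFun x := x ⟨0 + 1, by simp⟩ - x ⟨0, by simp⟩
        map_add' x y := by simp; ring
        map_smul' c x := by simp; ring }, fun ω => rfl⟩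
  · exact ⟨{clock τ + 1, clock τ, 0 + 1, 0, max τ 1 + 1, 2},
      { toFun x := (1 + min (τ : ℝ) 1) / 2 * (x ⟨clock τ + 1, by simp⟩ - x ⟨clock τ, by simp⟩)
          - (1 - min (τ : ℝ) 1) / 2 * (x ⟨0 + 1, by simp⟩ - x ⟨0, by simp⟩)
          + (x ⟨max τ 1 + 1, by simp⟩ - x ⟨2, by simp⟩)
        map_add' x y := by simp only [Pi.add_apply]; ring
        map_smul' c x := by simp only [Pi.smul_apply, smul_eq_mul, RingHom.id_apply]; ring },
      fun ω => rfl⟩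

lemma memLp_sub (hB : IsPreBrownianReal B P) (s t : ℝ≥0) :
    MemLp (fun ω => B s ω - B t ω) 2 P := by
  have h := fun t => (hB.isGaussianProcess.hasGaussianLaw_eval t).memLp_two
  exact (h s).sub (h t)

lemma memLp_slepian (hB : IsPreBrownianReal B P) (u : ℝ≥0) : MemLp (slepian B u) 2 P :=
  memLp_sub hB _ _

lemma covariance_sub_sub (hB : IsPreBrownianReal B P) (s t s' t' : ℝ≥0) :
    cov[fun ω => B s ω - B t ω, fun ω => B s' ω - B t' ω; P] =
      min (s : ℝ) s' - min (s : ℝ) t' - min (t : ℝ) s' + min (t : ℝ) t' := by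
  have := hB.isGaussianProcess.isProbabilityMeasure
  have h := fun t => (hB.isGaussianProcess.hasGaussianLaw_eval t).memLp_two
  rw [covariance_fun_sub_left (h _) (h _) (memLp_sub hB _ _),
    covariance_fun_sub_right (h _) (h _) (h _), covariance_fun_sub_right (h _) (h _) (h _),
    hB.covariance_eval, hB.covariance_eval, hB.covariance_eval, hB.covariance_eval]
  push_cast
  ring

lemma covariance_slepian (hB : IsPreBrownianReal B P) {u v : ℝ≥0} (hu : u ≤ 1) (hv : v ≤ 1) :
    cov[slepian B u, slepian B v; P] = 1 - |(u : ℝ) - v| := by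
  have hu' : (u : ℝ) ≤ 1 := by exact_mod_cast hu
  have hv' : (v : ℝ) ≤ 1 := by exact_mod_cast hv
  have hu0 : (0 : ℝ) ≤ u := u.2
  have hv0 : (0 : ℝ) ≤ v := v.2
  refine (covariance_sub_sub hB _ _ _ _).trans ?_
  push_cast
  rw [min_eq_right (show (v : ℝ) ≤ u + 1 by linarith),
    min_eq_left (show (u : ℝ) ≤ v + 1 by linarith)]
  rcases le_total (u : ℝ) v with h | h
  · rw [min_eq_left h, min_eq_left (show (u : ℝ) + 1 ≤ v + 1 by linarith),
      abs_of_nonpos (by linarith)]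
    ring
  · rw [min_eq_right h, min_eq_right (show (v : ℝ) + 1 ≤ u + 1 by linarith),
      abs_of_nonneg (by linarith)]
    ring

lemma covariance_slepian_sub (hB : IsPreBrownianReal B P) {u p : ℝ≥0} (hu : u ≤ 1) (hp : 1 ≤ p) :
    cov[slepian B u, fun ω => B (p + 1) ω - B 2 ω; P] = 0 := by
  have hu' : (u : ℝ) ≤ 1 := by exact_mod_cast hu
  have hp' : (1 : ℝ) ≤ p := by exact_mod_cast hp
  refine (covariance_sub_sub hB _ _ _ _).trans ?_
  push_cast
  rw [min_eq_left (show (u : ℝ) + 1 ≤ p + 1 by linarith),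
    min_eq_left (show (u : ℝ) + 1 ≤ 2 by linarith),
    min_eq_left (show (u : ℝ) ≤ p + 1 by linarith), min_eq_left (show (u : ℝ) ≤ 2 by linarith)]
  ring

lemma covariance_drivingBM_right (hB : IsPreBrownianReal B P) {X : Ω → ℝ} (hX : MemLp X 2 P)
    (τ : ℝ≥0) :
    cov[X, drivingBM B τ; P] = (1 + min (τ : ℝ) 1) / 2 * cov[X, slepian B (clock τ); P]
      - (1 - min (τ : ℝ) 1) / 2 * cov[X, slepian B 0; P]
      + cov[X, fun ω => B (max τ 1 + 1) ω - B 2 ω; P] := by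
  have := hB.isGaussianProcess.isProbabilityMeasure
  have h1 := (memLp_slepian hB (clock τ)).const_mul ((1 + min (τ : ℝ) 1) / 2)
  have h2 := (memLp_slepian hB 0).const_mul ((1 - min (τ : ℝ) 1) / 2)
  refine (covariance_add_right hX (h1.sub h2) (memLp_sub hB (max τ 1 + 1) 2)).trans ?_
  rw [covariance_sub_right hX h1 h2, covariance_const_mul_right, covariance_const_mul_right]

lemma memLp_drivingBM (hB : IsPreBrownianReal B P) (τ : ℝ≥0) : MemLp (drivingBM B τ) 2 P :=
  (((memLp_slepian hB (clock τ)).const_mul ((1 + min (τ : ℝ) 1) / 2)).sub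
    ((memLp_slepian hB 0).const_mul ((1 - min (τ : ℝ) 1) / 2))).add (memLp_sub hB _ _)

/-- For `τ ≤ 1` the clock satisfies `1 - u = (1 - τ) / (1 + τ)`, so the two Slepian terms cancel;
the continuation only uses increments of `B` after time `2`. -/
lemma covariance_slepian_zero_drivingBM (hB : IsPreBrownianReal B P) (τ : ℝ≥0) :
    cov[slepian B 0, drivingBM B τ; P] = 0 := by
  have h1 : 0 ≤ min (τ : ℝ) 1 := le_min τ.2 zero_le_one
  rw [covariance_drivingBM_right hB (memLp_slepian hB 0),
    covariance_slepian hB zero_le_one (clock_le_one τ),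
    covariance_slepian hB zero_le_one zero_le_one,
    covariance_slepian_sub hB zero_le_one (le_max_right _ _), NNReal.coe_zero, zero_sub, abs_neg,
    NNReal.abs_eq]
  simp only [coe_clock]
  field_simp
  simp
  ring

/-- The Slepian part contributes `min σ 1` and the continuation `max σ 1 - 1`; the cross terms
vanish. -/
lemma covariance_drivingBM (hB : IsPreBrownianReal B P) {σ τ : ℝ≥0} (h : σ ≤ τ) :
    cov[drivingBM B σ, drivingBM B τ; P] = σ := by
  have hσ : 0 ≤ min (σ : ℝ) 1 := le_min σ.2 zero_le_one
  have hτ : 0 ≤ min (τ : ℝ) 1 := le_min τ.2 zero_le_one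
  have hστ : max (σ : ℝ) 1 ≤ max (τ : ℝ) 1 := max_le_max_right _ (by exact_mod_cast h)
  have h1 : (1 : ℝ) ≤ max (σ : ℝ) 1 := le_max_right _ _
  let J : ℝ≥0 → Ω → ℝ := fun τ ω => B (max τ 1 + 1) ω - B 2 ω
  have hJ : ∀ τ, MemLp (J τ) 2 P := fun τ => memLp_sub hB _ _
  have e1 : cov[J τ, J σ; P] = max (σ : ℝ) 1 - 1 := by
    refine (covariance_sub_sub hB _ _ _ _).trans ?_
    push_cast
    rw [min_eq_right (show max (σ : ℝ) 1 + 1 ≤ max (τ : ℝ) 1 + 1 by linarith),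
      min_eq_right (show (2 : ℝ) ≤ max (τ : ℝ) 1 + 1 by linarith),
      min_eq_left (show (2 : ℝ) ≤ max (σ : ℝ) 1 + 1 by linarith), min_self]
    ring
  have e2 : ∀ u ≤ 1, cov[slepian B u, J σ; P] = 0 := fun u hu =>
    covariance_slepian_sub hB hu (le_max_right _ _)
  have e3 : ∀ u ≤ 1, cov[J τ, slepian B u; P] = 0 := fun u hu => by
    rw [covariance_comm]
    exact covariance_slepian_sub hB hu (le_max_right _ _)
  have e4 : cov[drivingBM B σ, slepian B (clock τ); P] =
      (1 + min (σ : ℝ) 1) / 2 * (1 - (clock τ - clock σ))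
        - (1 - min (σ : ℝ) 1) / 2 * (1 - clock τ) := by
    rw [covariance_comm, covariance_drivingBM_right hB (memLp_slepian hB _)]
    change _ + cov[slepian B (clock τ), J σ; P] = _
    rw [e2 _ (clock_le_one τ), covariance_slepian hB (clock_le_one _) (clock_le_one _),
      covariance_slepian hB (clock_le_one _) zero_le_one, NNReal.coe_zero, sub_zero, NNReal.abs_eq,
      abs_of_nonneg (sub_nonneg.2 (NNReal.coe_le_coe.2 (clock_mono h))), add_zero]
  have e5 : cov[drivingBM B σ, J τ; P] = max (σ : ℝ) 1 - 1 := by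
    rw [covariance_comm, covariance_drivingBM_right hB (hJ τ), e3 _ (clock_le_one σ),
      e3 _ zero_le_one]
    change _ + cov[J τ, J σ; P] = _
    rw [e1]
    ring
  rw [covariance_drivingBM_right hB (memLp_drivingBM hB σ), e4,
    covariance_comm (drivingBM B σ) (slepian B 0), covariance_slepian_zero_drivingBM hB]
  change _ + cov[drivingBM B σ, J τ; P] = _
  rw [e5]
  simp only [coe_clock]
  have := min_add_max (σ : ℝ) 1
  rw [← eq_sub_iff_add_eq'] at this
  rw [this]
  field_simp
  ring

/-- The driving process is a Brownian motion. -/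
lemma isBrownianReal_drivingBM (hB : IsBrownianReal B P) : IsBrownianReal (drivingBM B) P where
  toIsPreBrownianReal := by
    have hB' := hB.toIsPreBrownianReal
    refine IsGaussianProcess.isPreBrownianReal_of_covariance
      ((isGaussianProcess_sumElim hB').comp_right Sum.inr) (fun τ => ?_)
      (fun σ τ h => covariance_drivingBM hB' h)
    have := hB'.isGaussianProcess.isProbabilityMeasure
    have h0 : ∀ s t, ∫ ω, (B s ω - B t ω) ∂P = 0 := fun s t => by
      rw [integral_sub (hB'.integrable_eval _) (hB'.integrable_eval _), hB'.integral_eval,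
        hB'.integral_eval, sub_zero]
    have hi : ∀ s t, Integrable (fun ω => B s ω - B t ω) P := fun s t =>
      (memLp_sub hB' s t).integrable (by norm_num)
    simp only [drivingBM, slepian]
    have hi' : ∀ (a b : ℝ) s t s' t', Integrable
        (fun ω => a * (B s ω - B t ω) - b * (B s' ω - B t' ω)) P := fun a b s t s' t' =>
      ((hi _ _).const_mul _).sub ((hi _ _).const_mul _)
    rw [integral_add (hi' _ _ _ _ _ _) (hi _ _),
      integral_sub ((hi _ _).const_mul _) ((hi _ _).const_mul _), integral_const_mul,
      integral_const_mul, h0, h0, h0]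
    simp
  cont := by
    filter_upwards [hB.cont] with ω hω
    have := continuous_clock
    simp only [drivingBM, slepian]
    fun_prop

lemma indepFun_slepian_zero_drivingBM (hB : IsPreBrownianReal B P) :
    IndepFun (slepian B 0) (fun ω τ => drivingBM B τ ω) P := by
  have h := (isGaussianProcess_sumElim hB).indepFun_of_covariance_eq_zero
    (fun _ => (memLp_slepian hB 0).aemeasurable) (fun τ => (memLp_drivingBM hB τ).aemeasurable)
    (fun _ τ => covariance_slepian_zero_drivingBM hB τ)
  exact h.comp (φ := fun x : Unit → ℝ => x ()) (ψ := id) (by fun_prop) measurable_id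

lemma hasLaw_slepian_zero (hB : IsPreBrownianReal B P) :
    HasLaw (slepian B 0) (gaussianReal 0 1) P := by
  have h := hB.hasLaw_sub (0 + 1) 0
  have hd : nndist ((0 + 1 : ℝ≥0) : ℝ) ((0 : ℝ≥0) : ℝ) = 1 := by
    ext; simp
  rw [← hd]
  exact h

end Representation

/-! ### Two successive linear barriers -/

section TwoStage

variable {Ω : Type*} [MeasurableSpace Ω] {P : Measure Ω} {W : ℝ≥0 → Ω → ℝ}

/-- The probability that a Brownian motion stays below a line up to time `σ` and below a higher
line between the times `σ` and `σ + v`. -/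
theorem measure_stayBelow_inter_shift (hW : IsBrownianReal W P) {a c : ℝ} (ha : 0 < a)
    {σ : ℝ≥0} (hσ : σ ≠ 0) (v : ℝ≥0) {A : ℝ} (hA : a + c * σ ≤ A) (C : ℝ) :
    P {ω | ω ∈ stayBelow W a c σ ∧
        ∀ i, W (σ + grid v i) ω - W σ ω ≤ A - W σ ω + C * grid v i} =
      ∫⁻ y in Set.Iio (a + c * σ),
        ENNReal.ofReal (stayBelowDensity a c σ y * bachelierLevy (A - y) C (Real.sqrt v)) := by
  have := hW.isGaussianProcess.isProbabilityMeasure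
  have hm := hW.aemeasurable
  let U : Ω → ℕ × ℕ → ℝ := fun ω i => W (grid σ i) ω
  let V : ℝ≥0 → Ω → ℝ := fun r ω => W (σ + r) ω - W σ ω
  let Z : Ω → ℕ × ℕ → ℝ := fun ω i => V (grid v i) ω
  have hV : IsBrownianReal V P := hW.shift σ
  have hU : AEMeasurable U P := aemeasurable_pi_lambda _ fun i => hm _
  have hZ : AEMeasurable Z P := aemeasurable_pi_lambda _ fun i => hV.aemeasurable _
  have hUZ : IndepFun U Z P := by
    have h1 := (hW.toIsPreBrownianReal.indepFun_shift σ).symm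
    exact h1.comp (φ := fun (w : Set.Iic σ → ℝ) (i : ℕ × ℕ) => w ⟨grid σ i, grid_le σ i⟩)
      (ψ := fun (w : ℝ≥0 → ℝ) (i : ℕ × ℕ) => w (grid v i)) (by fun_prop)
      (measurable_pi_lambda _ fun i => measurable_pi_apply (X := fun _ : ℝ≥0 => ℝ) (grid v i))
  let K : Set (ℕ × ℕ → ℝ) := {u | ∀ i, u i ≤ a + c * grid σ i}
  have hK : MeasurableSet K := by
    simp only [K, Set.ofPred_forall]
    exact .iInter fun i => measurableSet_le (measurable_pi_apply _) measurable_const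
  let S : Set ((ℕ × ℕ → ℝ) × (ℕ × ℕ → ℝ)) :=
    {x | x.1 ∈ K ∧ ∀ i, x.2 i ≤ A - x.1 (0, 1) + C * grid v i}
  have hS : MeasurableSet S := by
    simp only [S, Set.ofPred_and, Set.ofPred_forall]
    exact (measurable_fst hK).inter
      (.iInter fun i => measurableSet_le (by fun_prop) (by fun_prop))
  have hUσ : ∀ ω, U ω (0, 1) = W σ ω := fun ω => by
    simp only [U]
    rw [show grid σ (0, 1) = σ from grid_last σ 0]
  have hevent : {ω | ω ∈ stayBelow W a c σ ∧
      ∀ i, W (σ + grid v i) ω - W σ ω ≤ A - W σ ω + C * grid v i} = {ω | (U ω, Z ω) ∈ S} := by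
    ext ω
    simp only [Set.mem_ofPred_eq, S, hUσ]
    rfl
  let Ψ : ℝ → ENNReal := fun y => P (stayBelow V (A - y) C v)
  -- Raising `y` lowers the barrier, so monotonicity alone gives measurability.
  have hΨ : Measurable Ψ := by
    refine Antitone.measurable fun y y' h => measure_mono fun ω hω i => ?_
    exact (hω i).trans (by linarith)
  -- Markov property: the past enters the second stage only through the coordinate `(0, 1)`, the
  -- value at the terminal time `σ`.
  have hsec : ∀ u, P {ω | (u, Z ω) ∈ S} = K.indicator (fun u => Ψ (u (0, 1))) u := by
    intro u
    by_cases hu : u ∈ K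
    · rw [Set.indicator_of_mem hu]
      simp only [Ψ, S, Set.mem_ofPred_eq, hu, true_and]
      rfl
    · simp [S, hu]
  have hΨ' : Measurable fun u : ℕ × ℕ → ℝ => Ψ (u (0, 1)) := hΨ.comp (measurable_pi_apply _)
  have hN := nullMeasurableSet_stayBelow hm a c σ
  rw [hevent, hUZ.measure_prodMk_mem hU hZ hS, lintegral_congr hsec,
    lintegral_map' (hΨ'.indicator hK).aemeasurable hU]
  have h1 : ∀ ω, K.indicator (fun u => Ψ (u (0, 1))) (U ω) =
      (stayBelow W a c σ).indicator (fun ω => Ψ (W σ ω)) ω := by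
    intro ω
    by_cases hω : ω ∈ stayBelow W a c σ
    · rw [Set.indicator_of_mem hω, Set.indicator_of_mem (show U ω ∈ K from hω), hUσ]
    · rw [Set.indicator_of_notMem hω, Set.indicator_of_notMem (show U ω ∉ K from hω)]
  rw [lintegral_congr h1, lintegral_indicator₀ hN,
    ← lintegral_map' hΨ.aemeasurable (hm σ).restrict, map_restrict_stayBelow hW ha hσ,
    lintegral_withDensity_eq_lintegral_mul _
      (continuous_stayBelowDensity a c σ).measurable.ennreal_ofReal hΨ]
  refine setLIntegral_congr_fun measurableSet_Iio fun y (hy : y < a + c * σ) => ?_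
  simp only [Pi.mul_apply, Ψ]
  rw [ENNReal.ofReal_mul (stayBelowDensity_nonneg ha hσ hy.le),
    ← measureReal_stayBelow hV (by linarith), ofReal_measureReal]

end TwoStage

/-! ### Translation of the running maxima into barriers -/

section Event

variable {Ω : Type*} {B : ℝ≥0 → Ω → ℝ} {ω : Ω}

/-- The inverse of `clock` on `[0, 1]`. -/
def unclock (u : ℝ≥0) : ℝ≥0 := u / (2 - u)

lemma coe_unclock {u : ℝ≥0} (hu : u ≤ 1) : (unclock u : ℝ) = u / (2 - u) := by
  simp [unclock, NNReal.coe_sub (hu.trans one_le_two)]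

lemma unclock_le_one {u : ℝ≥0} (hu : u ≤ 1) : unclock u ≤ 1 := by
  have hu' : (u : ℝ) ≤ 1 := by exact_mod_cast hu
  rw [← NNReal.coe_le_coe, coe_unclock hu, NNReal.coe_one, div_le_one (by linarith)]
  linarith

lemma unclock_le_unclock {u v : ℝ≥0} (huv : u ≤ v) (hv : v ≤ 1) : unclock u ≤ unclock v := by
  have hv' : (v : ℝ) ≤ 1 := by exact_mod_cast hv
  have huv' : (u : ℝ) ≤ v := by exact_mod_cast huv
  have hu : (0 : ℝ) ≤ u := u.2
  rw [← NNReal.coe_le_coe, coe_unclock (huv.trans hv), coe_unclock hv]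
  exact div_le_div₀ (hu.trans huv') huv' (by linarith) (by linarith)

lemma clock_unclock {u : ℝ≥0} (hu : u ≤ 1) : clock (unclock u) = u := by
  have hu' : (u : ℝ) ≤ 1 := by exact_mod_cast hu
  have h2 : (2 : ℝ) - u ≠ 0 := by linarith
  ext
  rw [coe_clock, min_eq_left (by exact_mod_cast unclock_le_one hu), coe_unclock hu]
  field_simp
  ring

lemma forall_slepian_le_iff {s : ℝ≥0} (hs : s ≤ 1) (m : ℝ) :
    (∀ u ≤ s, slepian B u ω ≤ m) ↔ ∀ τ ≤ unclock s, slepian B (clock τ) ω ≤ m := by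
  refine ⟨fun h τ hτ => h _ ((clock_mono hτ).trans_eq (clock_unclock hs)), fun h u hu => ?_⟩
  rw [← clock_unclock (hu.trans hs)]
  exact h _ (unclock_le_unclock hu hs)

lemma runningMax_le_iff (hω : Continuous (B · ω)) (s : ℝ≥0) (m : ℝ) :
    runningMax B s ω ≤ m ↔ ∀ u ≤ s, slepian B u ω ≤ m := by
  have hc : Continuous fun u => slepian B u ω := by unfold slepian; fun_prop
  rw [runningMax, csSup_le_iff (isCompact_Icc.image hc).bddAbove ⟨_, 0, ⟨le_rfl, zero_le⟩, rfl⟩]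
  simp

/-- Multiply by the positive factor `(1 + τ) / 2` and subtract `(1 - τ) / 2` times the initial
value. -/
lemma slepian_clock_le_iff {τ : ℝ≥0} (hτ : τ ≤ 1) (m : ℝ) :
    slepian B (clock τ) ω ≤ m ↔
      drivingBM B τ ω ≤ (m - slepian B 0 ω) / 2 + (m + slepian B 0 ω) / 2 * τ := by
  have h1 : (τ : ℝ) ≤ 1 := by exact_mod_cast hτ
  have h0 : (0 : ℝ) ≤ τ := τ.2
  have h2 : max τ 1 + 1 = 2 := by rw [max_eq_right hτ]; norm_num
  rw [drivingBM, h2, sub_self, add_zero, min_eq_left h1]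
  constructor <;> intro h <;> nlinarith

/-- Since `m ≤ M`, the level `M` matters only after `unclock s`. The second condition is written
with increments from that time, ready for the Markov property. -/
lemma runningMax_le_and_le_iff (hω : Continuous (B · ω)) {s t : ℝ≥0} (hst : s ≤ t) (ht : t ≤ 1)
    {m M : ℝ} (hmM : m ≤ M) :
    runningMax B s ω ≤ m ∧ runningMax B t ω ≤ M ↔
      (∀ i, drivingBM B (grid (unclock s) i) ω ≤
        (m - slepian B 0 ω) / 2 + (m + slepian B 0 ω) / 2 * grid (unclock s) i) ∧
      ∀ i, drivingBM B (unclock s + grid (unclock t - unclock s) i) ω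
          - drivingBM B (unclock s) ω ≤
        (M - slepian B 0 ω) / 2 + (M + slepian B 0 ω) / 2 * unclock s - drivingBM B (unclock s) ω
          + (M + slepian B 0 ω) / 2 * grid (unclock t - unclock s) i := by
  set σ := unclock s
  set T := unclock t
  have hσT : σ ≤ T := unclock_le_unclock hst ht
  have hT : T ≤ 1 := unclock_le_one ht
  have hcW : Continuous fun τ => drivingBM B τ ω := by
    have := continuous_clock
    simp only [drivingBM, slepian]
    fun_prop
  have e1 := forall_le_iff_forall_grid
    (f := fun τ => drivingBM B τ ω - ((m - slepian B 0 ω) / 2 + (m + slepian B 0 ω) / 2 * τ))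
    (by fun_prop) σ
  have e2 := forall_le_iff_forall_grid
    (f := fun r => drivingBM B (σ + r) ω - drivingBM B σ ω
      - ((M - slepian B 0 ω) / 2 + (M + slepian B 0 ω) / 2 * σ - drivingBM B σ ω
        + (M + slepian B 0 ω) / 2 * r)) (by fun_prop) (T - σ)
  simp only [sub_nonpos] at e1
  simp only [sub_nonpos] at e2
  rw [← e1, ← e2, runningMax_le_iff hω, runningMax_le_iff hω, forall_slepian_le_iff (hst.trans ht),
    forall_slepian_le_iff ht]
  constructor
  · rintro ⟨h1, h2⟩
    refine ⟨fun τ hτ => (slepian_clock_le_iff (hτ.trans (hσT.trans hT)) m).1 (h1 τ hτ),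
      fun r hr => ?_⟩
    have h3 : σ + r ≤ T := by
      rw [← add_tsub_cancel_of_le hσT]; gcongr
    have h4 := (slepian_clock_le_iff (h3.trans hT) M).1 (h2 _ h3)
    push_cast at h4
    linarith
  · rintro ⟨h1, h2⟩
    have h1' : ∀ τ ≤ σ, slepian B (clock τ) ω ≤ m := fun τ hτ =>
      (slepian_clock_le_iff (hτ.trans (hσT.trans hT)) m).2 (h1 τ hτ)
    refine ⟨h1', fun τ hτ => ?_⟩
    rcases le_total τ σ with h | h
    · exact (h1' τ h).trans hmM
    · have h3 := h2 (τ - σ) (tsub_le_tsub_right hτ σ)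
      rw [add_tsub_cancel_of_le h, NNReal.coe_sub h] at h3
      exact (slepian_clock_le_iff (hτ.trans hT) M).2 (by linarith)

end Event

/-! ### Factorisation of the integrand -/

section Integrand

lemma measurable_Phi : Measurable Phi := (monotone_cdf _).measurable

lemma measurable_integrand (sbar p q η δ m M : ℝ) :
    Measurable fun z : ℝ × ℝ => integrand sbar p q η δ m M z.1 z.2 := by
  have := measurable_Phi
  unfold integrand bachelierLevy
  split_ifs <;> fun_prop

lemma integrand_eq {σ : ℝ≥0} (hσ : σ ≠ 0) {p q η δ m M : ℝ} (hp : p = ((σ : ℝ) - 1) / 2)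
    (hq : q = ((σ : ℝ) + 1) / 2 * m) (x y : ℝ) :
    integrand σ p q η δ m M x y = gaussianPDFReal 0 1 x *
      (stayBelowDensity ((m - x) / 2) ((m + x) / 2) σ y *
        bachelierLevy (p * x + η - y) ((M + x) / 2) δ) := by
  have hσ' : (0 : ℝ) < σ := by positivity
  rw [stayBelowDensity_eq hσ, integrand, ← mul_assoc, ← mul_assoc]
  congr 1
  have e1 : (m - x) * (p * x + q - y) / σ =
      2 * ((m - x) / 2) * ((m - x) / 2 + (m + x) / 2 * σ - y) / σ := by
    rw [hp, hq]; ring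
  rw [e1]
  congr 1
  simp only [gaussianPDFReal, sub_zero, NNReal.coe_one, mul_one]
  have e2 : 2 * Real.pi * Real.sqrt σ = Real.sqrt (2 * Real.pi) * Real.sqrt (2 * Real.pi * σ) := by
    rw [Real.sqrt_mul (x := 2 * Real.pi) (by positivity), ← mul_assoc,
      Real.mul_self_sqrt (by positivity)]
  rw [e2, one_div, mul_inv, neg_div, neg_div]
  ring

end Integrand

end

end Slepian

/-! ### Integration over the initial value -/

theorem theorem2 {Ω : Type*} [MeasurableSpace Ω] (P : Measure Ω)
    (B : ℝ≥0 → Ω → ℝ) (hB : IsBrownianReal B P)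
    (s t : ℝ≥0) (hs : 0 < s) (hst : s ≤ t) (ht : t ≤ 1)
    (m M : ℝ) (hmM : m ≤ M)
    (sbar T p q η δ : ℝ)
    (hsbar : sbar = (s : ℝ) / (2 - (s : ℝ))) (hT : T = (t : ℝ) / (2 - (t : ℝ)))
    (hp : p = (sbar - 1) / 2) (hq : q = (sbar + 1) / 2 * m) (hη : η = (sbar + 1) / 2 * M)
    (hδ : δ = Real.sqrt (T - sbar)) :
    NullMeasurableSet {ω | Slepian.runningMax B s ω ≤ m ∧ Slepian.runningMax B t ω ≤ M} P ∧
    IntegrableOn (fun z : ℝ × ℝ => Slepian.integrand sbar p q η δ m M z.1 z.2)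
      {z : ℝ × ℝ | z.1 < m ∧ z.2 < p * z.1 + q} ∧
    P.real {ω | Slepian.runningMax B s ω ≤ m ∧ Slepian.runningMax B t ω ≤ M} =
      ∫ x in Set.Iio m, ∫ y in Set.Iio (p * x + q),
        Slepian.integrand sbar p q η δ m M x y := by
  open Slepian in
  have := hB.isGaussianProcess.isProbabilityMeasure
  have hs1 : s ≤ 1 := hst.trans ht
  have hs1' : (s : ℝ) ≤ 1 := by exact_mod_cast hs1
  set σ := unclock s with hσ_def
  have hσs : sbar = σ := by rw [hsbar, coe_unclock hs1]
  have hσT : σ ≤ unclock t := unclock_le_unclock hst ht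
  set v := unclock t - σ with hv_def
  have hv : T - sbar = v := by rw [NNReal.coe_sub hσT, hσs, hT, coe_unclock ht]
  have hσ : σ ≠ 0 := by
    have h0 : (0 : ℝ) < s := by exact_mod_cast hs
    have h1 : (0 : ℝ) < σ := by
      rw [coe_unclock hs1]
      exact div_pos h0 (by linarith)
    exact (NNReal.coe_pos.1 h1).ne'
  rw [hv] at hδ
  subst hσs
  have hW := isBrownianReal_drivingBM hB
  set W := drivingBM B with hW_def
  set X := slepian B 0 with hX_def
  have hX := (hasLaw_slepian_zero hB.toIsPreBrownianReal)
  let Z : Ω → (ℕ × ℕ → ℝ) × (ℕ × ℕ → ℝ) := fun ω =>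
    (fun i => W (grid σ i) ω, fun i => W (σ + grid v i) ω - W σ ω)
  have hZ : AEMeasurable Z P :=
    (aemeasurable_pi_lambda _ fun i => hW.aemeasurable _).prodMk
      (aemeasurable_pi_lambda _ fun i => (hW.aemeasurable _).sub (hW.aemeasurable _))
  have hXZ : IndepFun X Z P := by
    have h := indepFun_slepian_zero_drivingBM hB.toIsPreBrownianReal
    refine h.comp (φ := id) (ψ := fun w : ℝ≥0 → ℝ =>
      ((fun i => w (grid σ i), fun i => w (σ + grid v i) - w σ) :
        (ℕ × ℕ → ℝ) × (ℕ × ℕ → ℝ))) measurable_id ?_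
    have hw : ∀ r : ℝ≥0, Measurable fun w : ℝ≥0 → ℝ => w r := fun r => measurable_pi_apply _
    exact (measurable_pi_lambda _ fun i => hw _).prodMk
      (measurable_pi_lambda _ fun i => (hw _).sub (hw _))
  let S : Set (ℝ × (ℕ × ℕ → ℝ) × (ℕ × ℕ → ℝ)) := {z |
    (∀ i, z.2.1 i ≤ (m - z.1) / 2 + (m + z.1) / 2 * grid σ i) ∧
    ∀ i, z.2.2 i ≤ (M - z.1) / 2 + (M + z.1) / 2 * σ - z.2.1 (0, 1) + (M + z.1) / 2 * grid v i}
  have hS : MeasurableSet S := by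
    have hw : ∀ i, Measurable fun z : ℝ × (ℕ × ℕ → ℝ) × (ℕ × ℕ → ℝ) => z.2.1 i := by fun_prop
    have hw' : ∀ i, Measurable fun z : ℝ × (ℕ × ℕ → ℝ) × (ℕ × ℕ → ℝ) => z.2.2 i := by fun_prop
    simp only [S, Set.ofPred_and, Set.ofPred_forall]
    exact .inter (.iInter fun i => measurableSet_le (hw i) (by fun_prop))
      (.iInter fun i => measurableSet_le (hw' i) (by fun_prop))
  have hgrid : grid σ (0, 1) = σ := grid_last σ 0
  have hae : {ω | runningMax B s ω ≤ m ∧ runningMax B t ω ≤ M} =ᵐ[P] {ω | (X ω, Z ω) ∈ S} := by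
    filter_upwards [hB.cont] with ω hω
    refine propext ((runningMax_le_and_le_iff hω hst ht hmM).trans ?_)
    simp only [S, Z, Set.mem_ofPred_eq, hgrid]
    rfl
  have hnull : NullMeasurableSet {ω | (X ω, Z ω) ∈ S} P :=
    (hX.aemeasurable.prodMk hZ).nullMeasurable hS
  set R : Set (ℝ × ℝ) := {z : ℝ × ℝ | z.1 < m ∧ z.2 < p * z.1 + q} with hR_def
  have hR : MeasurableSet R := by
    simp only [hR_def, Set.ofPred_and]
    exact (measurableSet_lt (by fun_prop) (by fun_prop)).inter
      (measurableSet_lt (by fun_prop) (by fun_prop))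
  set f : ℝ × ℝ → ℝ := fun z => integrand σ p q η δ m M z.1 z.2 with hf_def
  have hf : Measurable f := measurable_integrand _ _ _ _ _ _ _
  have hline : ∀ x, p * x + q = (m - x) / 2 + (m + x) / 2 * σ := fun x => by rw [hp, hq]; ring
  have hline' : ∀ x, p * x + η = (M - x) / 2 + (M + x) / 2 * σ := fun x => by rw [hp, hη]; ring
  have hlines : ∀ x, p * x + q ≤ p * x + η := fun x => by
    rw [hq, hη]
    have : (0 : ℝ) ≤ σ := σ.2
    gcongr
  have hdens : ∀ x < m, ∀ y < p * x + q, 0 ≤ stayBelowDensity ((m - x) / 2) ((m + x) / 2) σ y *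
      bachelierLevy (p * x + η - y) ((M + x) / 2) δ := fun x hx y hy => by
    refine mul_nonneg (stayBelowDensity_nonneg (by linarith) hσ ?_) ?_
    · rw [← hline]; exact hy.le
    · rw [hδ, ← measureReal_stayBelow hW (by linarith [hlines x])]
      exact measureReal_nonneg
  have hfR : ∀ z ∈ R, 0 ≤ f z := fun z hz => by
    simp only [hf_def]
    rw [integrand_eq hσ hp hq]
    exact mul_nonneg (gaussianPDFReal_nonneg _ _ _) (hdens _ hz.1 _ hz.2)
  have hind : ∀ x y, R.indicator f (x, y) =
      (Set.Iio m).indicator (fun x => (Set.Iio (p * x + q)).indicator (fun y => f (x, y)) y) x := by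
    intro x y
    by_cases hx : x < m <;> by_cases hy : y < p * x + q <;>
      simp [Set.indicator, hR_def, hx, hy]
  have hprob : P {ω | (X ω, Z ω) ∈ S} = ∫⁻ z, ENNReal.ofReal (R.indicator f z) := by
    rw [hXZ.measure_prodMk_mem hX.aemeasurable hZ hS, hX.map_eq,
      gaussianReal_of_var_ne_zero _ one_ne_zero, lintegral_withDensity_eq_lintegral_mul_non_measurable
        _ (measurable_gaussianPDF 0 1) (ae_of_all _ fun _ => gaussianPDF_lt_top),
      Measure.volume_eq_prod,
      lintegral_prod _ ((hf.indicator hR).ennreal_ofReal).aemeasurable]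
    -- At `x = m` the line starts at height `0`, where the two-stage formula does not apply.
    have hne : ∀ᵐ x : ℝ, x ≠ m := Measure.ae_ne _ m
    refine lintegral_congr_ae ?_
    filter_upwards [hne] with x hxm
    simp only [Pi.mul_apply]
    rcases lt_or_gt_of_ne hxm with hx | hx
    · have hset : {ω | (x, Z ω) ∈ S} = {ω | ω ∈ stayBelow W ((m - x) / 2) ((m + x) / 2) σ ∧
          ∀ i, W (σ + grid v i) ω - W σ ω ≤ p * x + η - W σ ω + (M + x) / 2 * grid v i} := by
        rw [hline']
        simp only [S, Z, Set.mem_ofPred_eq, hgrid]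
        rfl
      rw [hset, measure_stayBelow_inter_shift hW (by linarith) hσ v
        (by rw [← hline]; exact hlines x), ← lintegral_const_mul' _ _ gaussianPDF_ne_top, ← hline,
        ← lintegral_indicator measurableSet_Iio]
      refine lintegral_congr fun y => ?_
      rw [hind, Set.indicator_of_mem (show x ∈ Set.Iio m from hx)]
      by_cases hy : y < p * x + q
      · rw [Set.indicator_of_mem (show y ∈ Set.Iio (p * x + q) from hy),
          Set.indicator_of_mem (show y ∈ Set.Iio (p * x + q) from hy), gaussianPDF,
          ← ENNReal.ofReal_mul (gaussianPDFReal_nonneg _ _ _), hf_def, ← hδ]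
        simp only
        rw [integrand_eq hσ hp hq]
      · rw [Set.indicator_of_notMem (show y ∉ Set.Iio (p * x + q) from hy),
          Set.indicator_of_notMem (show y ∉ Set.Iio (p * x + q) from hy), ENNReal.ofReal_zero]
    -- For `x > m` the line starts below `0`, so the barrier is already violated at time `0`.
    · have h1 : P {ω | (x, Z ω) ∈ S} = 0 := by
        refine measure_mono_null (t := {ω | ¬ W 0 ω = 0}) (fun ω hω h0 => ?_)
          hW.eval_zero_ae_eq_zero
        have h2 := hω.1 (0, 0)
        simp only [Z, grid_zero, h0] at h2
        simp only [NNReal.coe_zero, mul_zero, add_zero] at h2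
        linarith
      rw [h1, mul_zero]
      simp [hind, Set.indicator_of_notMem (show x ∉ Set.Iio m from not_lt.2 hx.le)]
  have hnn : 0 ≤ᵐ[volume] R.indicator f := ae_of_all _ fun z => Set.indicator_nonneg hfR z
  -- The integrand is nonnegative on the region and its total mass is a probability, so
  -- integrability needs no estimate.
  have hint : Integrable (R.indicator f) := by
    refine ⟨(hf.indicator hR).aestronglyMeasurable, ?_⟩
    rw [hasFiniteIntegral_iff_ofReal hnn, ← hprob]
    exact measure_lt_top _ _
  refine ⟨hnull.congr hae.symm, (integrable_indicator_iff hR).1 hint, ?_⟩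
  rw [measureReal_congr hae, measureReal_def, hprob,
    ← integral_eq_lintegral_of_nonneg_ae hnn hint.1, Measure.volume_eq_prod,
    integral_prod _ (by rw [← Measure.volume_eq_prod]; exact hint),
    ← integral_indicator measurableSet_Iio]
  refine integral_congr_ae (ae_of_all _ fun x => ?_)
  by_cases hx : x < m
  · simp only [hind, Set.indicator_of_mem (show x ∈ Set.Iio m from hx)]
    exact integral_indicator measurableSet_Iio
  · simp [hind, Set.indicator_of_notMem (show x ∉ Set.Iio m from hx)]
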